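/- For an integer $k\ge 1$ define $F_k:\mathbb N\to\mathbb N$ by $F_k(0)=0$ and $F_k(n)=n-F_k^k(n-1)$ for $n\ge 1$, where the exponent of a function denotes iteration. Let $\tau_k$ be the substitution on the alphabet $\{1,\dots,k\}$ given by $k\mapsto k1$ and $i\mapsto i+1$ for $1\le i<k$, and let $x_k=x_k[0]x_k[1]\cdots$ be the infinite word fixed by $\tau_k$. Let $L_k(n)=|\tau_k(x_k[0]\cdots x_k[n-1])|$ for $n\ge 0$, and write $L_k^j$ for its $j$-th iterate. For a letter $1\le i\le k$, let $\mathrm{freq}_k(i)$ denote the limit $\lim_{n\to\infty}\frac1n\#\{0\le p<n : x_k[p]=i\}$. Let $\alpha_k$ be the unique positive root of $X^k+X-1$ and let $\beta_k$ be the unique positive root of $X^k-X^{k-1}-1$, so that $\beta_k=1/\alpha_k$. Theorem. For all $j\ge 0$ and $k\ge 1$, the following limits exist and have the given values: $$\lim_{n\to\infty}\tfrac1n F_k^j(n)=\alpha_k^j,\qquad \lim_{n\to\infty}\tfrac1n L_k^j(n)=\beta_k^j,$$ $$\mathrm{freq}_k(i)=\alpha_k^{k+i-1}\ \text{ for } 1\le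 i<k,\qquad \mathrm{freq}_k(k)=\alpha_k^{k-1}=\beta_k-1.$$ -/

import Mathlib

namespace Hofstadter

/-! ### The functions `F_k` -/

/-- `hofTable k n` is a function whose values at `0, …, n` are those of Hofstadter's `F_k`
(and which is `0` above `n`). -/
def hofTable (k : ℕ) : ℕ → ℕ → ℕ
  | 0 => fun _ => 0
  | n + 1 => Function.update (hofTable k n) (n + 1) (n + 1 - (hofTable k n)^[k] n)

/-- Hofstadter's function `F_k`, i.e. `F_k(0) = 0` and `F_k(n) = n - F_k^k(n-1)` for `n ≥ 1`,
the exponent being iteration; see `hofF_zero` and `hofF_succ` for these two equations. -/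
def hofF (k n : ℕ) : ℕ := hofTable k n n

theorem hofF_le (k n : ℕ) : hofF k n ≤ n := by
  cases n with
  | zero => simp [hofF, hofTable]
  | succ n => simp [hofF, hofTable]

theorem hofTable_eq (k n m : ℕ) (h : m ≤ n) : hofTable k n m = hofF k m := by
  induction n with
  | zero =>
    obtain rfl : m = 0 := by omega
    rfl
  | succ n ih =>
    rcases Nat.lt_or_ge n m with h' | h'
    · obtain rfl : m = n + 1 := by omega
      rfl
    · have hne : m ≠ n + 1 := by omega
      simp [hofTable, Function.update_of_ne hne, ih h']

theorem hofF_zero (k : ℕ) : hofF k 0 = 0 := rfl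

theorem hofF_succ (k n : ℕ) : hofF k (n + 1) = n + 1 - (hofF k)^[k] n := by
  have key : ∀ i : ℕ, (hofTable k n)^[i] n = (hofF k)^[i] n ∧ (hofF k)^[i] n ≤ n := by
    intro i
    induction i with
    | zero => simp
    | succ i ih =>
      rw [Function.iterate_succ_apply', Function.iterate_succ_apply', ih.1]
      exact ⟨hofTable_eq k n _ ih.2, (hofF_le k _).trans ih.2⟩
  rw [← (key k).1]
  simp [hofF, hofTable]

/-- The subtraction in `hofF_succ` is not truncated. -/
theorem hofF_succ_add (k n : ℕ) : hofF k (n + 1) + (hofF k)^[k] n = n + 1 := by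
  have key : ∀ i : ℕ, (hofF k)^[i] n ≤ n := by
    intro i
    induction i with
    | zero => simp
    | succ i ih =>
      rw [Function.iterate_succ_apply']
      exact (hofF_le k _).trans ih
  have := key k
  rw [hofF_succ]
  omega

/-! ### The substitutions `τ_k` and the words `x_k` -/

/-- The image of a letter under `τ_k`: `k ↦ k1` and `i ↦ i+1` for the other letters. -/
def tauLetter (k i : ℕ) : List ℕ := if i = k then [k, 1] else [i + 1]

/-- The substitution `τ_k` on finite words. The alphabet is `{1, …, k}`, embedded in `ℕ`. -/
def tau (k : ℕ) (w : List ℕ) : List ℕ := w.flatMap (tauLetter k)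

/-- The prefix `w[0] w[1] ⋯ w[n-1]` of length `n` of the infinite word `w`. -/
def pref (w : ℕ → ℕ) (n : ℕ) : List ℕ := (List.range n).map w

/-- The infinite word `w` satisfies `τ_k(w) = w`: the image of each prefix is a prefix of `w`
(images of letters are nonempty, so these images have unbounded lengths). -/
def IsFixedWord (k : ℕ) (w : ℕ → ℕ) : Prop :=
  ∀ n, tau k (pref w n) = pref w (tau k (pref w n)).length

/-- The infinite word `x_k`, the limit of the words `τ_k^n(k)`, each of which is a prefix of the
next. It is the unique fixed point of `τ_k`, see `isFixedWord_iff`. -/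
def word (k n : ℕ) : ℕ := ((tau k)^[n] [k]).getD n 0

theorem length_pref (w : ℕ → ℕ) (n : ℕ) : (pref w n).length = n := by simp [pref]

theorem tau_append (k : ℕ) (u v : List ℕ) : tau k (u ++ v) = tau k u ++ tau k v := by
  simp [tau]

theorem tau_prefix (k : ℕ) {u v : List ℕ} (h : u <+: v) : tau k u <+: tau k v := by
  obtain ⟨t, rfl⟩ := h
  exact ⟨tau k t, (tau_append k u t).symm⟩

theorem length_le_length_tau (k : ℕ) (w : List ℕ) : w.length ≤ (tau k w).length := by
  induction w with
  | nil => simp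
  | cons a w ih =>
    have : 1 ≤ (tauLetter k a).length := by unfold tauLetter; split <;> simp
    simp only [tau, List.flatMap_cons, List.length_append, List.length_cons] at ih ⊢
    omega

theorem iterate_prefix_succ (k n : ℕ) : (tau k)^[n] [k] <+: (tau k)^[n + 1] [k] := by
  induction n with
  | zero => exact ⟨[1], by simp [tau, tauLetter]⟩
  | succ n ih =>
    rw [Function.iterate_succ_apply', Function.iterate_succ_apply' _ (n + 1)]
    exact tau_prefix k ih

theorem iterate_prefix (k : ℕ) {m n : ℕ} (h : m ≤ n) : (tau k)^[m] [k] <+: (tau k)^[n] [k] := by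
  induction n, h using Nat.le_induction with
  | base => exact List.prefix_refl _
  | succ n _ ih => exact ih.trans (iterate_prefix_succ k n)

theorem lt_length_iterate (k n : ℕ) : n < ((tau k)^[n] [k]).length := by
  induction n with
  | zero => simp
  | succ n ih =>
    obtain ⟨t, ht⟩ := iterate_prefix k (Nat.zero_le n)
    rw [Function.iterate_succ_apply']
    rw [← ht] at ih ⊢
    have := length_le_length_tau k t
    rw [tau_append]
    simp [tau, tauLetter] at this ih ⊢
    omega

theorem pref_word (k j : ℕ) :
    pref (word k) ((tau k)^[j] [k]).length = (tau k)^[j] [k] := by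
  apply List.ext_getElem (length_pref _ _)
  intro n h1 h2
  simp only [pref, List.getElem_map, List.getElem_range, word]
  have hn := lt_length_iterate k n
  rw [List.getD_eq_getElem _ _ hn]
  rcases le_total n j with h | h
  · exact (iterate_prefix k h).getElem hn
  · exact ((iterate_prefix k h).getElem h2).symm

theorem pref_prefix (w : ℕ → ℕ) {m n : ℕ} (h : m ≤ n) : pref w m <+: pref w n := by
  obtain ⟨d, rfl⟩ := Nat.exists_eq_add_of_le h
  exact ⟨(List.range d).map (fun i => w (m + i)), by simp [pref, List.range_add]⟩

theorem eq_pref_of_prefix (w : ℕ → ℕ) {u : List ℕ} {n : ℕ} (h : u <+: pref w n) :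
    u = pref w u.length := by
  have hl : u.length ≤ n := by simpa [length_pref] using h.length_le
  have h' := List.prefix_of_prefix_length_le h (pref_prefix w hl) (by rw [length_pref])
  exact h'.eq_of_length (by rw [length_pref])

theorem isFixedWord_word (k : ℕ) : IsFixedWord k (word k) := by
  intro n
  have h1 : pref (word k) n <+: (tau k)^[n] [k] := by
    rw [← pref_word k n]
    exact pref_prefix _ (lt_length_iterate k n).le
  have h2 := tau_prefix k h1
  rw [← Function.iterate_succ_apply' (tau k) n, ← pref_word k (n + 1)] at h2
  exact eq_pref_of_prefix _ h2

/-- `x_k` is the only infinite word fixed by `τ_k`. -/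
theorem isFixedWord_iff (k : ℕ) (w : ℕ → ℕ) : IsFixedWord k w ↔ w = word k := by
  refine ⟨fun h => ?_, fun h => h ▸ isFixedWord_word k⟩
  have h0 : w 0 = k := by
    by_contra hne
    have := h 1
    simp [pref, tau, tauLetter, hne] at this
  have hw : ∀ j, (tau k)^[j] [k] = pref w ((tau k)^[j] [k]).length := by
    intro j
    induction j with
    | zero => simp [pref, h0]
    | succ j ih =>
      rw [Function.iterate_succ_apply']
      rw [ih]
      exact h _
  funext n
  have hn := lt_length_iterate k n
  have e : pref w ((tau k)^[n] [k]).length = pref (word k) ((tau k)^[n] [k]).length := by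
    rw [← hw, pref_word]
  have := congrArg (fun l : List ℕ => l.getD n 0) e
  simpa [pref, hn] using this

/-- The letters of `x_k` belong to the alphabet `{1, …, k}`. -/
theorem word_mem (k : ℕ) (hk : 1 ≤ k) (n : ℕ) : 1 ≤ word k n ∧ word k n ≤ k := by
  have key : ∀ j, ∀ a ∈ (tau k)^[j] [k], 1 ≤ a ∧ a ≤ k := by
    intro j
    induction j with
    | zero => simp [hk]
    | succ j ih =>
      intro a ha
      rw [Function.iterate_succ_apply'] at ha
      simp only [tau, List.mem_flatMap] at ha
      obtain ⟨b, hb, hab⟩ := ha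
      have := ih b hb
      unfold tauLetter at hab
      split at hab <;> simp at hab <;> omega
  have hn := lt_length_iterate k n
  apply key n
  rw [word, List.getD_eq_getElem _ _ hn]
  exact List.getElem_mem hn

/-- `L_k(n)`, the length of the image under `τ_k` of the prefix of length `n` of `x_k`. -/
def lenL (k n : ℕ) : ℕ := (tau k (pref (word k) n)).length

/-- The number of occurrences of the letter `i` in the prefix of length `n` of `x_k`. -/
def letterCount (k i n : ℕ) : ℕ := ((Finset.range n).filter (fun p => word k p = i)).card

/-- The frequency of the letter `i` in `x_k`, i.e. the limit of the proportion of the letters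
equal to `i` in the prefix of length `n`, exists and is equal to `ℓ`. -/
def HasFreq (k i : ℕ) (ℓ : ℝ) : Prop :=
  Filter.Tendsto (fun n : ℕ => (letterCount k i n : ℝ) / (n : ℝ)) Filter.atTop (nhds ℓ)

/-! ### The numbers `α_k` and `β_k` -/

/-- `P_k = X^k + X - 1`. -/
noncomputable def polyP (k : ℕ) : Polynomial ℝ := Polynomial.X ^ k + Polynomial.X - 1

/-- `Q_k = X^k - X^(k-1) - 1` (used for `k ≥ 1`). -/
noncomputable def polyQ (k : ℕ) : Polynomial ℝ :=
  Polynomial.X ^ k - Polynomial.X ^ (k - 1) - 1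

theorem existsUnique_root_polyP (k : ℕ) (hk : 1 ≤ k) :
    ∃! x : ℝ, 0 < x ∧ (polyP k).IsRoot x := by
  have hk0 : k ≠ 0 := by omega
  have hiff : ∀ x : ℝ, (polyP k).IsRoot x ↔ x ^ k + x = 1 := by
    intro x
    simp [polyP, Polynomial.IsRoot, sub_eq_zero]
  have hc : ContinuousOn (fun x : ℝ => x ^ k + x) (Set.Icc 0 1) := by fun_prop
  have h1 : (1 : ℝ) ∈ Set.Icc ((fun x : ℝ => x ^ k + x) 0) ((fun x : ℝ => x ^ k + x) 1) := by
    simp [hk0]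
  obtain ⟨x, hx, hx1⟩ := intermediate_value_Icc (zero_le_one' ℝ) hc h1
  have hx1' : x ^ k + x = 1 := hx1
  have hxpos : 0 < x := by
    rcases hx.1.lt_or_eq with h | h
    · exact h
    · rw [← h] at hx1'
      simp [hk0] at hx1'
  refine ⟨x, ⟨hxpos, (hiff x).2 hx1'⟩, ?_⟩
  rintro y ⟨hy, hyr⟩
  have hy1 := (hiff y).1 hyr
  rcases lt_trichotomy x y with h | h | h
  · have := pow_lt_pow_left₀ h hxpos.le hk0
    linarith
  · exact h.symm
  · have := pow_lt_pow_left₀ h hy.le hk0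
    linarith

theorem isRoot_polyQ_iff (k : ℕ) (hk : 1 ≤ k) (x : ℝ) (hx : 0 < x) :
    (polyQ k).IsRoot x ↔ (polyP k).IsRoot (1 / x) := by
  obtain ⟨m, rfl⟩ := Nat.exists_eq_add_of_le' hk
  have hm : x ^ m ≠ 0 := (pow_pos hx m).ne'
  have hx0 : x ≠ 0 := hx.ne'
  have e : x ^ (m + 1) - x ^ m - 1 = -(x ^ (m + 1)) * ((1 / x) ^ (m + 1) + 1 / x - 1) := by
    rw [one_div, inv_pow, pow_succ]
    field_simp
    ring
  have hne : -(x ^ (m + 1)) ≠ 0 := neg_ne_zero.2 (pow_pos hx _).ne'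
  have hQ : (polyQ (m + 1)).IsRoot x ↔ x ^ (m + 1) - x ^ m - 1 = 0 := by
    simp [polyQ, Polynomial.IsRoot]
  have hP : (polyP (m + 1)).IsRoot (1 / x) ↔ (1 / x) ^ (m + 1) + 1 / x - 1 = 0 := by
    simp [polyP, Polynomial.IsRoot]
  rw [hQ, hP, e, mul_eq_zero]
  simp only [hne, false_or]

theorem existsUnique_root_polyQ (k : ℕ) (hk : 1 ≤ k) :
    ∃! x : ℝ, 0 < x ∧ (polyQ k).IsRoot x := by
  obtain ⟨a, ⟨ha, har⟩, hu⟩ := existsUnique_root_polyP k hk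
  refine ⟨1 / a, ⟨by positivity, ?_⟩, ?_⟩
  · rw [isRoot_polyQ_iff k hk _ (by positivity), one_div_one_div]
    exact har
  · rintro y ⟨hy, hyr⟩
    rw [isRoot_polyQ_iff k hk y hy] at hyr
    have := hu (1 / y) ⟨by positivity, hyr⟩
    rw [← this, one_div_one_div]

/-- `α_k`, the unique positive root of `P_k`, for `k ≥ 1`. -/
noncomputable def alpha (k : ℕ) (hk : 1 ≤ k) : ℝ := (existsUnique_root_polyP k hk).choose

/-- `β_k`, the unique positive root of `Q_k`, for `k ≥ 1`. -/
noncomputable def beta (k : ℕ) (hk : 1 ≤ k) : ℝ := (existsUnique_root_polyQ k hk).choose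

theorem alpha_spec (k : ℕ) (hk : 1 ≤ k) : 0 < alpha k hk ∧ (polyP k).IsRoot (alpha k hk) :=
  (existsUnique_root_polyP k hk).choose_spec.1

theorem beta_spec (k : ℕ) (hk : 1 ≤ k) : 0 < beta k hk ∧ (polyQ k).IsRoot (beta k hk) :=
  (existsUnique_root_polyQ k hk).choose_spec.1

theorem beta_eq (k : ℕ) (hk : 1 ≤ k) : beta k hk = 1 / alpha k hk := by
  obtain ⟨hb, hbr⟩ := beta_spec k hk
  rw [isRoot_polyQ_iff k hk _ hb] at hbr
  have := (existsUnique_root_polyP k hk).unique ⟨by positivity, hbr⟩ (alpha_spec k hk)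
  rw [← this, one_div_one_div]

end Hofstadter

namespace Hofstadter

open Filter Topology

/-! ### The recursive structure of the fixed word -/

/-! Everything reduces to the growth of `lenL k`, written L; write F for `hofF k`, α and β for the
two roots. The positions of the letter k in the word are exactly the range of L^(k-1)
(`word_eq_iff`), and L(n) is n plus the number of letters k before position n. Hence L^k = L^(k-1) +
id (`iterate_lenL_recurrence`).

Along an orbit of L, the rescaled values α^p L^p(n) therefore satisfy a convex recurrence. Their
oscillation decays geometrically, at a rate uniform in n (`exists_interval_of_convex_recurrence`),
so for a suitable fixed p, L(q)/q is uniformly close to β at all positive q in the range of L^p.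
This range has bounded gaps, which gives L(n)/n → β (`tendsto_lenL_div`) with no spectral theory.

F is the lower adjoint of L (`galoisConnection_hofF_lenL`), so L(F(n)) = n + O(1) and F(n)/n → 1/β =
α. The frequency of k is read off L(n) - n; the substitution sends occurrences of k to those of 1,
then of 2, and so on, each passage costing a factor α (`HasFreq.of_lenL`). -/

theorem pref_succ (w : ℕ → ℕ) (n : ℕ) : pref w (n + 1) = pref w n ++ [w n] := by
  simp [pref, List.range_succ]

theorem lenL_zero (k : ℕ) : lenL k 0 = 0 := by simp [lenL, pref, tau]

theorem tau_pref_word (k n : ℕ) : tau k (pref (word k) n) = pref (word k) (lenL k n) :=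
  isFixedWord_word k n

theorem pref_lenL_succ (k n : ℕ) :
    pref (word k) (lenL k (n + 1)) = pref (word k) (lenL k n) ++ tauLetter k (word k n) := by
  rw [← tau_pref_word, pref_succ, tau_append, tau_pref_word]
  simp [tau]

theorem lenL_succ (k n : ℕ) : lenL k (n + 1) = lenL k n + if word k n = k then 2 else 1 := by
  have h := congrArg List.length (pref_lenL_succ k n)
  rw [List.length_append, length_pref, length_pref] at h
  rw [h, tauLetter]
  split <;> rfl

theorem word_lenL (k n : ℕ) : word k (lenL k n) = if word k n = k then k else word k n + 1 := by
  have h := pref_lenL_succ k n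
  have hs := lenL_succ k n
  unfold tauLetter at h
  split at h <;> rename_i hk <;> simp only [hk, if_true, if_false] at hs ⊢
  · rw [hs, pref_succ, pref_succ, List.append_assoc, List.append_cancel_left_eq] at h
    simpa using (List.cons.inj h).1
  · rw [hs, pref_succ, List.append_cancel_left_eq] at h
    exact (List.cons.inj h).1

theorem word_lenL_add_one (k n : ℕ) (hn : word k n = k) : word k (lenL k n + 1) = 1 := by
  have h := pref_lenL_succ k n
  have hs := lenL_succ k n
  simp only [tauLetter, hn, if_true] at h hs
  rw [hs, pref_succ, pref_succ, List.append_assoc, List.append_cancel_left_eq] at h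
  exact (List.cons.inj (List.cons.inj h).2).1

theorem lenL_strictMono (k : ℕ) : StrictMono (lenL k) := by
  refine strictMono_nat_of_lt_succ fun n => ?_
  rw [lenL_succ]
  split <;> omega

theorem lenL_add_le (k n d : ℕ) : lenL k (n + d) ≤ lenL k n + 2 * d := by
  induction d with
  | zero => simp
  | succ d ih =>
    rw [← add_assoc, lenL_succ]
    split <;> omega

theorem iterate_lenL_add_le (k p n d : ℕ) :
    (lenL k)^[p] (n + d) ≤ (lenL k)^[p] n + 2 ^ p * d := by
  induction p with
  | zero => simp
  | succ p ih =>
    rw [Function.iterate_succ_apply', Function.iterate_succ_apply']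
    calc _ ≤ lenL k ((lenL k)^[p] n + 2 ^ p * d) := (lenL_strictMono k).monotone ih
      _ ≤ _ := lenL_add_le _ _ _
      _ = _ := by ring

theorem iterate_lenL_strictMono (k p : ℕ) : StrictMono (lenL k)^[p] :=
  (lenL_strictMono k).iterate p

theorem iterate_lenL_zero (k p : ℕ) : (lenL k)^[p] 0 = 0 :=
  Function.iterate_fixed (lenL_zero k) p

theorem exists_eq_lenL (k m : ℕ) :
    ∃ n, m = lenL k n ∨ (m = lenL k n + 1 ∧ word k n = k) := by
  induction m with
  | zero => exact ⟨0, Or.inl (lenL_zero k).symm⟩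
  | succ m ih =>
    obtain ⟨n, rfl | ⟨rfl, hn⟩⟩ := ih
    · by_cases hn : word k n = k
      · exact ⟨n, Or.inr ⟨rfl, hn⟩⟩
      · exact ⟨n + 1, Or.inl (by simp [lenL_succ, hn])⟩
    · exact ⟨n + 1, Or.inl (by simp [lenL_succ, hn])⟩

/-- Each application of `lenL k` to a position raises its letter by one, with a cap at k. -/
theorem le_word_iterate_lenL (k : ℕ) (hk : 1 ≤ k) (j n : ℕ) (hj : j < k) :
    j + 1 ≤ word k ((lenL k)^[j] n) := by
  induction j with
  | zero => simpa using (word_mem k hk n).1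
  | succ j ih =>
    rw [Function.iterate_succ_apply', word_lenL]
    have := ih (by omega)
    split <;> omega

/-- A letter other than 1 cannot be the second letter of the image of k, so it begins the image of
some letter; desubstituting lowers it by at most one. -/
theorem exists_eq_iterate_lenL (k j m : ℕ) (hj : j + 1 ≤ word k m) :
    ∃ n, m = (lenL k)^[j] n := by
  induction j generalizing m with
  | zero => exact ⟨m, rfl⟩
  | succ j ih =>
    obtain ⟨n, rfl | ⟨rfl, hn⟩⟩ := exists_eq_lenL k m
    · obtain ⟨q, rfl⟩ := ih n (by rw [word_lenL] at hj; split at hj <;> omega)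
      exact ⟨q, (Function.iterate_succ_apply' _ _ _).symm⟩
    · rw [word_lenL_add_one k n hn] at hj
      omega

theorem word_eq_iff (k : ℕ) (hk : 1 ≤ k) (m : ℕ) :
    word k m = k ↔ m ∈ Set.range (lenL k)^[k - 1] := by
  constructor
  · intro h
    obtain ⟨n, hn⟩ := exists_eq_iterate_lenL k (k - 1) m (by omega)
    exact ⟨n, hn.symm⟩
  · rintro ⟨n, rfl⟩
    have := le_word_iterate_lenL k hk (k - 1) n (by omega)
    have := (word_mem k hk ((lenL k)^[k - 1] n)).2
    omega

/-- Exactly one of `n + 1 ∈ range L_k` and `n ∈ range L_k^k` holds. -/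
theorem mem_range_iterate_lenL_iff (k : ℕ) (hk : 1 ≤ k) (n : ℕ) :
    n ∈ Set.range (lenL k)^[k] ↔ n + 1 ∉ Set.range (lenL k) := by
  obtain ⟨l, rfl⟩ := Nat.exists_eq_add_of_le' hk
  have hl (m : ℕ) := word_eq_iff (l + 1) hk m
  simp only [Nat.add_sub_cancel] at hl
  constructor
  · rintro ⟨q, rfl⟩ ⟨m, hm⟩
    rw [Function.iterate_succ_apply'] at hm
    set p := (lenL (l + 1))^[l] q with hp
    have hw : word (l + 1) p = l + 1 := (hl p).2 ⟨q, hp.symm⟩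
    have h2 := lenL_succ (l + 1) p
    rw [if_pos hw] at h2
    -- Here L(m) = L(p) + 1 would lie strictly between the consecutive values L(p) and L(p + 1) =
    -- L(p) + 2.
    have h3 := (lenL_strictMono (l + 1)).lt_iff_lt (a := p) (b := m)
    have h4 := (lenL_strictMono (l + 1)).lt_iff_lt (a := m) (b := p + 1)
    omega
  · intro h
    obtain ⟨m, hm | ⟨hm, hw⟩⟩ := exists_eq_lenL (l + 1) (n + 1)
    · exact absurd ⟨m, hm.symm⟩ h
    · obtain ⟨q, hq⟩ := (hl m).1 hw
      refine ⟨q, ?_⟩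
      rw [Function.iterate_succ_apply', hq]
      omega

/-! ### Letter counts -/

theorem letterCount_zero (k i : ℕ) : letterCount k i 0 = 0 := by simp [letterCount]

theorem letterCount_succ (k i n : ℕ) :
    letterCount k i (n + 1) = letterCount k i n + if word k n = i then 1 else 0 := by
  simp only [letterCount, Finset.range_add_one, Finset.filter_insert]
  split <;> simp

theorem lenL_eq_add (k n : ℕ) : lenL k n = n + letterCount k k n := by
  induction n with
  | zero => simp [lenL_zero, letterCount_zero]
  | succ n ih =>
    rw [lenL_succ, letterCount_succ, ih]
    split <;> omega

/-- For k > 1 the letter 1 arises only as the second letter of the image of k. -/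
theorem letterCount_one_lenL (k : ℕ) (hk : 1 < k) (n : ℕ) :
    letterCount k 1 (lenL k n) = letterCount k k n := by
  induction n with
  | zero => simp [lenL_zero, letterCount_zero]
  | succ n ih =>
    have h1 := (word_mem k hk.le n).1
    rw [lenL_succ, letterCount_succ]
    by_cases hn : word k n = k
    · rw [if_pos hn, if_pos hn, letterCount_succ, letterCount_succ, word_lenL_add_one k n hn,
        word_lenL, if_pos hn, if_neg hk.ne', ih]
      simp
    · rw [if_neg hn, if_neg hn, letterCount_succ, word_lenL, if_neg hn, if_neg (by omega), ih]

/-- The letter i + 1 has i as its only ancestor; i + 1 = k is excluded because k also descends from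
itself. -/
theorem letterCount_succ_lenL (k i : ℕ) (hi : 1 ≤ i) (hik : i + 1 < k) (n : ℕ) :
    letterCount k (i + 1) (lenL k n) = letterCount k i n := by
  induction n with
  | zero => simp [lenL_zero, letterCount_zero]
  | succ n ih =>
    rw [lenL_succ, letterCount_succ]
    by_cases hn : word k n = k
    · rw [if_pos hn, letterCount_succ, letterCount_succ, word_lenL_add_one k n hn,
        word_lenL, if_pos hn, if_neg (by omega), if_neg (by omega), if_neg (by omega), ih]
    · rw [if_neg hn, letterCount_succ, word_lenL, if_neg hn, ih]
      simp

theorem letterCount_mono (k i : ℕ) : Monotone (letterCount k i) := by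
  refine monotone_nat_of_le_succ fun n => ?_
  rw [letterCount_succ]
  omega

theorem letterCount_le_add (k i : ℕ) {m n : ℕ} (h : m ≤ n) :
    letterCount k i n ≤ letterCount k i m + (n - m) := by
  induction n, h using Nat.le_induction with
  | base => simp
  | succ n hn ih =>
    rw [letterCount_succ]
    split <;> omega

/-- The strictly increasing map L^(k-1) enumerates the occurrences of k. -/
theorem letterCount_iterate_lenL (k : ℕ) (hk : 1 ≤ k) (n : ℕ) :
    letterCount k k ((lenL k)^[k - 1] n) = n := by
  have hm := iterate_lenL_strictMono k (k - 1)
  have : (Finset.range ((lenL k)^[k - 1] n)).filter (fun p => word k p = k) =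
      (Finset.range n).image (lenL k)^[k - 1] := by
    ext m
    simp only [Finset.mem_filter, Finset.mem_range, Finset.mem_image, word_eq_iff k hk]
    constructor
    · rintro ⟨h, q, rfl⟩
      exact ⟨q, hm.lt_iff_lt.1 h, rfl⟩
    · rintro ⟨q, h, rfl⟩
      exact ⟨hm h, q, rfl⟩
  rw [letterCount, this, Finset.card_image_of_injective _ hm.injective, Finset.card_range]

theorem iterate_lenL_recurrence (k : ℕ) (hk : 1 ≤ k) (n : ℕ) :
    (lenL k)^[k] n = (lenL k)^[k - 1] n + n := by
  obtain ⟨l, rfl⟩ := Nat.exists_eq_add_of_le' hk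
  have h := letterCount_iterate_lenL (l + 1) hk n
  rw [Nat.add_sub_cancel] at h ⊢
  rw [Function.iterate_succ_apply', lenL_eq_add, h]

/-! ### `F_k` is the lower adjoint of `L_k` -/

/-- The lower adjoint counts: g(n) is the number of m with f(m) < n. -/
theorem lower_adjoint_succ {f g : ℕ → ℕ} (hf : StrictMono f) (h : GaloisConnection g f) (n : ℕ)
    [Decidable (n ∈ Set.range f)] :
    g (n + 1) = g n + if n ∈ Set.range f then 1 else 0 := by
  split
  · rename_i hn
    obtain ⟨m, rfl⟩ := hn
    have e : g (f m) = m := by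
      refine le_antisymm ((h _ _).2 le_rfl) ?_
      exact hf.le_iff_le.1 (h.le_u_l (f m))
    rw [e]
    refine le_antisymm ((h _ _).2 (hf (Nat.lt_succ_self m))) ?_
    by_contra hc
    have := (h (f m + 1) m).1 (by omega)
    omega
  · rename_i hn
    refine le_antisymm ((h _ _).2 ?_) (h.monotone_l (Nat.le_succ n))
    refine Nat.succ_le_of_lt (lt_of_le_of_ne (h.le_u_l n) fun e => hn ⟨g n, e.symm⟩)

theorem iterate_galoisConnection {f g : ℕ → ℕ} (h : GaloisConnection g f) (j : ℕ) :
    GaloisConnection g^[j] f^[j] := by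
  induction j with
  | zero => exact GaloisConnection.id
  | succ j ih =>
    intro a b
    rw [Function.iterate_succ_apply', Function.iterate_succ_apply, h, ih]

theorem exists_lower_adjoint {f : ℕ → ℕ} (hf : StrictMono f) :
    ∃ g : ℕ → ℕ, GaloisConnection g f := by
  have hex (n : ℕ) : ∃ m, n ≤ f m := ⟨n, hf.le_apply⟩
  refine ⟨fun n => Nat.find (hex n), fun n m => ⟨fun h => ?_, fun h => Nat.find_le h⟩⟩
  exact (Nat.find_spec (hex n)).trans (hf.monotone h)

theorem iterate_hofF_le (k j n : ℕ) : (hofF k)^[j] n ≤ n := by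
  induction j with
  | zero => simp
  | succ j ih =>
    rw [Function.iterate_succ_apply']
    exact (hofF_le k _).trans ih

/-- The lower adjoint g of L satisfies Hofstadter's recursion: by `mem_range_iterate_lenL_iff`, when
n increases by one, exactly one of g(n + 1) and g^k(n) increases, so their sum tracks n + 1. The
recursion determines F. -/
theorem galoisConnection_hofF_lenL (k : ℕ) (hk : 1 ≤ k) : GaloisConnection (hofF k) (lenL k) := by
  classical
  obtain ⟨g, hg⟩ := exists_lower_adjoint (lenL_strictMono k)
  have hg0 (j : ℕ) : g^[j] 0 = 0 :=
    Nat.le_zero.1 ((iterate_galoisConnection hg j _ _).2 (Nat.zero_le _))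
  have hs := lower_adjoint_succ (lenL_strictMono k) hg
  have hsk := lower_adjoint_succ (iterate_lenL_strictMono k k) (iterate_galoisConnection hg k)
  have hrec (n : ℕ) : g (n + 1) + g^[k] n = n + 1 := by
    induction n with
    | zero =>
      rw [hs, hg0, if_pos ⟨0, lenL_zero k⟩]
      have := hg0 1
      simp only [Function.iterate_one] at this
      omega
    | succ n ih =>
      have hiff := mem_range_iterate_lenL_iff k hk n
      by_cases h : n + 1 ∈ Set.range (lenL k)
      · rw [hs, hsk, if_pos h, if_neg fun h' => hiff.1 h' h]
        omega
      · rw [hs, hsk, if_neg h, if_pos (hiff.2 h)]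
        omega
  have key : ∀ n, hofF k n = g n := by
    intro n
    induction n using Nat.strong_induction_on with
    | _ n ih =>
      cases n with
      | zero => exact (hg0 1).symm
      | succ n =>
        have hit (j : ℕ) : (hofF k)^[j] n = g^[j] n := by
          induction j with
          | zero => rfl
          | succ j ihj =>
            have hle := iterate_hofF_le k j n
            rw [Function.iterate_succ_apply', Function.iterate_succ_apply', ← ihj]
            exact ih _ (by omega)
        have h1 := hofF_succ_add k n
        have h2 := hrec n
        rw [hit k] at h1
        omega
  rwa [funext key]

theorem le_lenL_hofF (k : ℕ) (hk : 1 ≤ k) (n : ℕ) : n ≤ lenL k (hofF k n) :=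
  (galoisConnection_hofF_lenL k hk).le_u_l n

/-- Every integer is reached from below by an iterate of `L_k` up to a bounded error. -/
theorem iterate_lenL_iterate_hofF_le (k : ℕ) (hk : 1 ≤ k) (p n : ℕ) :
    (lenL k)^[p] ((hofF k)^[p] n) ≤ n + 2 ^ p := by
  have hgc := iterate_galoisConnection (galoisConnection_hofF_lenL k hk) p
  rcases h : (hofF k)^[p] n with _ | m
  · rw [iterate_lenL_zero]
    exact Nat.zero_le _
  · have h1 := iterate_lenL_add_le k p m 1
    -- By adjunction m + 1 is the least argument at which L^p reaches n.
    have h2 : (lenL k)^[p] m < n := hgc.lt_iff_lt.1 (by omega)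
    omega

/-! ### The real numbers `α_k` and `β_k` -/

theorem alpha_pow_add (k : ℕ) (hk : 1 ≤ k) : alpha k hk ^ k + alpha k hk = 1 := by
  have := (alpha_spec k hk).2
  simpa [polyP, Polynomial.IsRoot, sub_eq_zero] using this

theorem alpha_lt_one (k : ℕ) (hk : 1 ≤ k) : alpha k hk < 1 := by
  have := alpha_pow_add k hk
  have := pow_pos (alpha_spec k hk).1 k
  linarith

theorem alpha_pow_pred (k : ℕ) (hk : 1 ≤ k) : alpha k hk ^ (k - 1) = beta k hk - 1 := by
  have ha := (alpha_spec k hk).1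
  have h := alpha_pow_add k hk
  rw [beta_eq]
  obtain ⟨l, rfl⟩ := Nat.exists_eq_add_of_le' hk
  rw [pow_succ] at h
  rw [Nat.add_sub_cancel]
  field_simp
  linarith

/-! ### Contraction of a convex linear recurrence -/

/-- The solutions of a recurrence `u(p+k) = a u(p+k-1) + (1-a) u(p)` have exponentially small
oscillation. -/
theorem exists_interval_of_convex_recurrence {k : ℕ} (hk : 1 ≤ k) {a : ℝ} (ha : 0 < a)
    (ha1 : a < 1) {u : ℕ → ℝ} (hu : ∀ p, u (p + k) = a * u (p + k - 1) + (1 - a) * u p)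
    {m₀ M₀ : ℝ} (h₀ : ∀ p < k, u p ∈ Set.Icc m₀ M₀) (N : ℕ) :
    ∃ m M : ℝ, m₀ ≤ m ∧ M - m ≤ (1 - a ^ k) ^ N * (M₀ - m₀) ∧
      ∀ p, N * k ≤ p → u p ∈ Set.Icc m M := by
  -- By convexity, an interval containing k consecutive terms contains all later ones.
  have stay {m M : ℝ} {s : ℕ} (hs : ∀ p, s ≤ p → p < s + k → u p ∈ Set.Icc m M) :
      ∀ p, s ≤ p → u p ∈ Set.Icc m M := by
    intro p
    induction p using Nat.strong_induction_on with
    | _ p ih =>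
      intro hp
      rcases lt_or_ge p (s + k) with h | h
      · exact hs p hp h
      · obtain ⟨q, rfl⟩ := Nat.exists_eq_add_of_le' (show k ≤ p by omega)
        have h1 := ih (q + k - 1) (by omega) (by omega)
        have h2 := ih q (by omega) (by omega)
        rw [hu q]
        exact convex_Icc m M h1 h2 ha.le (by linarith) (by ring)
  induction N with
  | zero =>
    refine ⟨m₀, M₀, le_rfl, by simp, ?_⟩
    rw [zero_mul]
    exact stay fun p _ hp => h₀ p (by omega)
  | succ N ih =>
    obtain ⟨m, M, hm, hMm, hin⟩ := ih
    -- The last term x of the current block keeps weight at least a^k in each of the next k terms.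
    -- This pulls both endpoints towards x and shrinks the width by the factor 1 - a^k.
    set x := u (N * k + k - 1) with hx
    have hxm := hin (N * k + k - 1) (by omega)
    rw [← hx] at hxm
    have step (j : ℕ) : m + a ^ j * (x - m) ≤ u (N * k + k - 1 + j) ∧
        u (N * k + k - 1 + j) ≤ M - a ^ j * (M - x) := by
      induction j with
      | zero => simp [← hx]
      | succ j ihj =>
        have e := hu (N * k + j)
        rw [show N * k + j + k = N * k + k - 1 + (j + 1) by omega,
          show N * k + k - 1 + (j + 1) - 1 = N * k + k - 1 + j by omega] at e
        have h2 := hin (N * k + j) (by omega)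
        rw [e, pow_succ]
        have h3 := mul_le_mul_of_nonneg_left ihj.1 ha.le
        have h4 := mul_le_mul_of_nonneg_left ihj.2 ha.le
        have h5 := mul_le_mul_of_nonneg_left h2.1 (sub_nonneg.2 ha1.le)
        have h6 := mul_le_mul_of_nonneg_left h2.2 (sub_nonneg.2 ha1.le)
        constructor <;> linarith
    have hak := pow_pos ha k
    refine ⟨m + a ^ k * (x - m), M - a ^ k * (M - x), ?_, ?_, ?_⟩
    · have := mul_nonneg hak.le (sub_nonneg.2 hxm.1)
      linarith
    · have h1 : 0 ≤ 1 - a ^ k := sub_nonneg.2 (pow_le_one₀ ha.le ha1.le)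
      have := mul_le_mul_of_nonneg_left hMm h1
      rw [pow_succ]
      linarith
    · refine stay fun p hp hpk => ?_
      rw [add_mul, one_mul] at hp hpk
      obtain ⟨j, rfl⟩ := Nat.exists_eq_add_of_le (show N * k + k - 1 ≤ p by omega)
      have hj : a ^ k ≤ a ^ j := pow_le_pow_of_le_one ha.le ha1.le (by omega)
      have h1 := mul_le_mul_of_nonneg_right hj (sub_nonneg.2 hxm.1)
      have h2 := mul_le_mul_of_nonneg_right hj (sub_nonneg.2 hxm.2)
      have := step j
      constructor <;> linarith

/-! ### The growth of `L_k` -/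

theorem iterate_lenL_le (k p n : ℕ) : (lenL k)^[p] n ≤ 2 ^ p * n := by
  simpa [iterate_lenL_zero] using iterate_lenL_add_le k p 0 n

/-- The oscillation and the lower bound of α^p L^p(n) are both controlled by multiples of n, so the
relative error is uniform and p can be chosen before n. -/
theorem exists_iterate_lenL_error (k : ℕ) (hk : 1 ≤ k) {ε : ℝ} (hε : 0 < ε) :
    ∃ p : ℕ, ∀ n : ℕ, |(lenL k ((lenL k)^[p] n) : ℝ) - beta k hk * ((lenL k)^[p] n : ℕ)| ≤
      ε * ((lenL k)^[p] n : ℕ) := by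
  set a := alpha k hk with hadef
  have ha : 0 < a := (alpha_spec k hk).1
  have ha1 : a < 1 := alpha_lt_one k hk
  have hak : a ^ k + a = 1 := alpha_pow_add k hk
  have hakp := pow_pos ha k
  have hθ : Tendsto (fun N : ℕ => (1 - a ^ k) ^ N * (2 ^ k - a ^ k)) atTop (𝓝 0) := by
    have := (tendsto_pow_atTop_nhds_zero_of_lt_one (r := 1 - a ^ k) (by linarith)
      (by linarith)).mul_const (2 ^ k - a ^ k)
    simpa using this
  -- The initial interval is [a^k n, 2^k n]. The factor a^k makes the error relative to u, and the
  -- extra a compensates for u(p + 1) - u(p) carrying a^(p + 1).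
  obtain ⟨N, hN⟩ := (hθ.eventually (gt_mem_nhds (show 0 < ε * a * a ^ k by positivity))).exists
  refine ⟨N * k, fun n => ?_⟩
  set u : ℕ → ℝ := fun p => a ^ p * ((lenL k)^[p] n : ℕ) with hudef
  have hu (p : ℕ) : u (p + k) = a * u (p + k - 1) + (1 - a) * u p := by
    have h := iterate_lenL_recurrence k hk ((lenL k)^[p] n)
    rw [← Function.iterate_add_apply, ← Function.iterate_add_apply] at h
    have hpk : p + k - 1 = k - 1 + p := by omega
    have e : a ^ (k + p) = a * a ^ (k - 1 + p) := by
      rw [← pow_succ']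
      congr 1
      omega
    have e' : a ^ (k + p) = (1 - a) * a ^ p := by
      rw [pow_add]
      congr 1
      linarith
    simp only [hudef]
    rw [hpk, add_comm p k, h, Nat.cast_add, mul_add]
    nth_rewrite 1 [e]
    rw [e']
    ring
  have h₀ : ∀ p < k, u p ∈ Set.Icc (a ^ k * n) (2 ^ k * n) := by
    intro p hp
    have h1 : (n : ℝ) ≤ ((lenL k)^[p] n : ℕ) := by
      exact_mod_cast (iterate_lenL_strictMono k p).le_apply
    have h2 : (((lenL k)^[p] n : ℕ) : ℝ) ≤ 2 ^ p * n := by exact_mod_cast iterate_lenL_le k p n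
    constructor
    · exact mul_le_mul (pow_le_pow_of_le_one ha.le ha1.le hp.le) h1 (by positivity)
        (by positivity)
    · calc u p ≤ 1 * ((lenL k)^[p] n : ℕ) :=
            mul_le_mul_of_nonneg_right (pow_le_one₀ ha.le ha1.le) (by positivity)
        _ ≤ 2 ^ p * n := by rwa [one_mul]
        _ ≤ 2 ^ k * n := by
            gcongr
            norm_num
  obtain ⟨m, M, hm, hMm, hin⟩ := exists_interval_of_convex_recurrence hk ha ha1 hu h₀ N
  have i1 := hin (N * k) le_rfl
  have i2 := hin (N * k + 1) (by omega)
  have hsmall : M - m ≤ ε * a * u (N * k) := by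
    calc M - m ≤ (1 - a ^ k) ^ N * (2 ^ k * n - a ^ k * n) := hMm
      _ = (1 - a ^ k) ^ N * (2 ^ k - a ^ k) * n := by ring
      _ ≤ ε * a * a ^ k * n := by gcongr
      _ = ε * a * (a ^ k * n) := by ring
      _ ≤ ε * a * u (N * k) := by
          have := hm.trans i1.1
          gcongr
  have habs : |u (N * k + 1) - u (N * k)| ≤ ε * a * u (N * k) :=
    (abs_le.2 ⟨by linarith [i1.2, i2.1], by linarith [i1.1, i2.2]⟩ : _ ≤ M - m).trans hsmall
  have hpos : 0 < a ^ (N * k + 1) := by positivity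
  have e1 : u (N * k + 1) - u (N * k) = a ^ (N * k + 1) *
      ((lenL k ((lenL k)^[N * k] n) : ℝ) - beta k hk * ((lenL k)^[N * k] n : ℕ)) := by
    simp only [hudef]
    rw [beta_eq, ← hadef, Function.iterate_succ_apply', pow_succ]
    field_simp
  have e2 : ε * a * u (N * k) = a ^ (N * k + 1) * (ε * ((lenL k)^[N * k] n : ℕ)) := by
    simp only [hudef]
    ring
  rw [e1, e2, abs_mul, abs_of_pos hpos] at habs
  exact le_of_mul_le_mul_left habs hpos

theorem tendsto_lenL_div (k : ℕ) (hk : 1 ≤ k) :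
    Tendsto (fun n : ℕ => (lenL k n : ℝ) / n) atTop (𝓝 (beta k hk)) := by
  have hb : 0 < beta k hk := (beta_spec k hk).1
  rw [Metric.tendsto_atTop]
  intro ε hε
  obtain ⟨p, hp⟩ := exists_iterate_lenL_error k hk (half_pos hε)
  set C : ℝ := 2 ^ p with hC
  have hCpos : 0 < C := by positivity
  obtain ⟨n₀, hn₀⟩ := exists_nat_gt ((2 * C + beta k hk * C + ε / 2 * C) / (ε / 2))
  refine ⟨n₀ + 1, fun n hn => ?_⟩
  have hnpos : (0 : ℝ) < n := by exact_mod_cast (by omega : 0 < n)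
  have hnn : (n₀ : ℝ) ≤ n := by exact_mod_cast (by omega : n₀ ≤ n)
  have hbig : 2 * C + beta k hk * C + ε / 2 * C < ε / 2 * n := by
    have := (div_lt_iff₀ (half_pos hε)).1 (hn₀.trans_le hnn)
    linarith
  have hlow : n ≤ (lenL k)^[p] ((hofF k)^[p] n) :=
    (iterate_galoisConnection (galoisConnection_hofF_lenL k hk) p).le_u_l n
  have hupp := iterate_lenL_iterate_hofF_le k hk p n
  have he := hp ((hofF k)^[p] n)
  -- This q lies in [n, n + 2^p]; replacing n by q changes L(n) and β n by bounded amounts, absorbed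
  -- by the choice of `n₀`.
  set q := (lenL k)^[p] ((hofF k)^[p] n)
  have h1 : (lenL k n : ℝ) ≤ lenL k q := by exact_mod_cast (lenL_strictMono k).monotone hlow
  have h2 : (lenL k q : ℝ) ≤ lenL k n + 2 * C := by
    have := ((lenL_strictMono k).monotone hupp).trans (lenL_add_le k n (2 ^ p))
    rw [hC]
    exact_mod_cast this
  have h3 : (n : ℝ) ≤ q := by exact_mod_cast hlow
  have h4 : (q : ℝ) ≤ n + C := by
    rw [hC]
    exact_mod_cast hupp
  have h5 := mul_le_mul_of_nonneg_left h3 hb.le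
  have h6 := mul_le_mul_of_nonneg_left h4 hb.le
  have h7 := mul_le_mul_of_nonneg_left h4 (half_pos hε).le
  have hbC := mul_pos hb hCpos
  have heC := mul_pos hε hCpos
  obtain ⟨h8, h9⟩ := abs_le.1 he
  have e : (lenL k n : ℝ) / n - beta k hk = (lenL k n - beta k hk * n) / n := by
    field_simp
  rw [Real.dist_eq, e, abs_div, abs_of_pos hnpos, div_lt_iff₀ hnpos, abs_lt]
  constructor <;> linarith

/-! ### Limits -/

theorem tendsto_atTop_of_div {f : ℕ → ℕ} {c : ℝ} (hc : 0 < c)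
    (hf : Tendsto (fun n => (f n : ℝ) / n) atTop (𝓝 c)) : Tendsto f atTop atTop := by
  rw [← tendsto_natCast_atTop_iff (R := ℝ)]
  refine (hf.pos_mul_atTop hc tendsto_natCast_atTop_atTop).congr' ?_
  filter_upwards [eventually_gt_atTop 0] with n hn
  have : (n : ℝ) ≠ 0 := by exact_mod_cast hn.ne'
  field_simp

theorem tendsto_iterate_div {f : ℕ → ℕ} {c : ℝ} (hc : 0 < c)
    (hf : Tendsto (fun n => (f n : ℝ) / n) atTop (𝓝 c)) (j : ℕ) :
    Tendsto (fun n => (f^[j] n : ℝ) / n) atTop (𝓝 (c ^ j)) := by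
  induction j with
  | zero =>
    refine (tendsto_congr' ?_).2 tendsto_const_nhds
    filter_upwards [eventually_gt_atTop 0] with n hn
    have : (n : ℝ) ≠ 0 := by exact_mod_cast hn.ne'
    simp [this]
  | succ j ih =>
    have hj := tendsto_atTop_of_div (pow_pos hc j) ih
    rw [pow_succ']
    refine ((hf.comp hj).mul ih).congr' ?_
    filter_upwards [hj.eventually_gt_atTop 0] with n hn
    have : ((f^[j] n : ℕ) : ℝ) ≠ 0 := by exact_mod_cast hn.ne'
    simp only [Function.comp_apply, Function.iterate_succ_apply']
    field_simp

theorem tendsto_hofF_atTop (k : ℕ) (hk : 1 ≤ k) : Tendsto (hofF k) atTop atTop :=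
  (galoisConnection_hofF_lenL k hk).monotone_l.tendsto_atTop_atTop fun b =>
    ⟨lenL k b + 1, by
      have := (galoisConnection_hofF_lenL k hk).lt_iff_lt (a := lenL k b + 1) (b := b)
      omega⟩

theorem abs_lenL_hofF_sub_le (k : ℕ) (hk : 1 ≤ k) (n : ℕ) :
    |(lenL k (hofF k n) : ℝ) - n| ≤ 2 := by
  have h1 : (n : ℝ) ≤ lenL k (hofF k n) := by exact_mod_cast le_lenL_hofF k hk n
  have h2 : (lenL k (hofF k n) : ℝ) ≤ n + 2 := by
    exact_mod_cast iterate_lenL_iterate_hofF_le k hk 1 n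
  rw [abs_le]
  constructor <;> linarith

theorem tendsto_div_natCast_of_abs_le {f : ℕ → ℝ} {C : ℝ} (hf : ∀ n, |f n| ≤ C) :
    Tendsto (fun n : ℕ => f n / n) atTop (𝓝 0) := by
  refine squeeze_zero_norm (fun n => ?_) (tendsto_const_div_atTop_nhds_zero_nat C)
  rw [Real.norm_eq_abs, abs_div, Nat.abs_cast]
  exact div_le_div_of_nonneg_right (hf n) (Nat.cast_nonneg n)

theorem tendsto_lenL_hofF_div (k : ℕ) (hk : 1 ≤ k) :
    Tendsto (fun n : ℕ => (lenL k (hofF k n) : ℝ) / n) atTop (𝓝 1) := by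
  have h := (tendsto_div_natCast_of_abs_le (abs_lenL_hofF_sub_le k hk)).add_const 1
  rw [zero_add] at h
  refine h.congr' ?_
  filter_upwards [eventually_gt_atTop 0] with n hn
  have : (n : ℝ) ≠ 0 := by exact_mod_cast hn.ne'
  field_simp
  ring

/-- Divide L(F(n))/n → 1 by L(F(n))/F(n) → β. -/
theorem tendsto_hofF_div (k : ℕ) (hk : 1 ≤ k) :
    Tendsto (fun n : ℕ => (hofF k n : ℝ) / n) atTop (𝓝 (alpha k hk)) := by
  have hb := (beta_spec k hk).1
  have hF := tendsto_hofF_atTop k hk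
  have h := (tendsto_lenL_hofF_div k hk).div ((tendsto_lenL_div k hk).comp hF) hb.ne'
  rw [beta_eq, one_div_one_div] at h
  refine h.congr' ?_
  filter_upwards [eventually_gt_atTop 0, hF.eventually_gt_atTop 0] with n hn hFn
  have h1 : (n : ℝ) ≠ 0 := by exact_mod_cast hn.ne'
  have h2 : (hofF k n : ℝ) ≠ 0 := by exact_mod_cast hFn.ne'
  have h3 : (lenL k (hofF k n) : ℝ) ≠ 0 := by
    exact_mod_cast (hFn.trans_le (lenL_strictMono k).le_apply).ne'
  simp only [Pi.div_apply, Function.comp_apply]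
  field_simp

theorem hasFreq_self (k : ℕ) (hk : 1 ≤ k) : HasFreq k k (beta k hk - 1) := by
  refine ((tendsto_lenL_div k hk).sub_const 1).congr' ?_
  filter_upwards [eventually_gt_atTop 0] with n hn
  have h1 : (n : ℝ) ≠ 0 := by exact_mod_cast hn.ne'
  rw [lenL_eq_add]
  push_cast
  field_simp
  ring

/-- If the occurrences of `i'` in the image of each prefix are as many as the occurrences of `i`
in this prefix, then the frequency of `i'` is `α_k` times the frequency of `i`. -/
theorem HasFreq.of_lenL {k i i' : ℕ} {ℓ : ℝ} (hk : 1 ≤ k)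
    (h : ∀ n, letterCount k i' (lenL k n) = letterCount k i n) (hi : HasFreq k i ℓ) :
    HasFreq k i' (alpha k hk * ℓ) := by
  have hF := tendsto_hofF_atTop k hk
  have hlim := (tendsto_hofF_div k hk).mul (hi.comp hF)
  have herr : Tendsto (fun n : ℕ =>
      ((letterCount k i' n : ℝ) - letterCount k i' (lenL k (hofF k n))) / n) atTop (𝓝 0) := by
    -- Every n is within 2 of the image length L(F(n)), where `h` applies.
    refine tendsto_div_natCast_of_abs_le (C := 2) fun n => ?_
    have hle := le_lenL_hofF k hk n
    have hup : lenL k (hofF k n) ≤ n + 2 := iterate_lenL_iterate_hofF_le k hk 1 n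
    have h1 := letterCount_mono k i' hle
    have h2 := letterCount_le_add k i' hle
    have h3 : letterCount k i' (lenL k (hofF k n)) ≤ letterCount k i' n + 2 := by omega
    have h1' : (letterCount k i' n : ℝ) ≤ letterCount k i' (lenL k (hofF k n)) := by
      exact_mod_cast h1
    have h3' : (letterCount k i' (lenL k (hofF k n)) : ℝ) ≤ letterCount k i' n + 2 := by
      exact_mod_cast h3
    rw [abs_le]
    constructor <;> linarith
  have := hlim.add herr
  rw [add_zero] at this
  refine this.congr' ?_
  filter_upwards [eventually_gt_atTop 0, hF.eventually_gt_atTop 0] with n hn hFn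
  have h1 : (n : ℝ) ≠ 0 := by exact_mod_cast hn.ne'
  have h2 : (hofF k n : ℝ) ≠ 0 := by exact_mod_cast hFn.ne'
  simp only [Function.comp_apply, h]
  field_simp
  ring

theorem hasFreq_of_lt (k : ℕ) (hk : 1 ≤ k) (i : ℕ) (hi : 1 ≤ i) (hik : i < k) :
    HasFreq k i (alpha k hk ^ (k + i - 1)) := by
  induction i, hi using Nat.le_induction with
  | base =>
    have := (hasFreq_self k hk).of_lenL hk (letterCount_one_lenL k hik)
    rwa [← alpha_pow_pred, ← pow_succ', show k - 1 + 1 = k + 1 - 1 by omega] at this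
  | succ i hi ih =>
    have := (ih (by omega)).of_lenL hk (letterCount_succ_lenL k i hi hik)
    rwa [← pow_succ', show k + i - 1 + 1 = k + (i + 1) - 1 by omega] at this

end Hofstadter

theorem theorem6p1 (k : ℕ) (hk : 1 ≤ k) :
    (∀ j : ℕ, Filter.Tendsto (fun n : ℕ => (((Hofstadter.hofF k)^[j] n : ℕ) : ℝ) / (n : ℝ))
      Filter.atTop (nhds (Hofstadter.alpha k hk ^ j))) ∧
    (∀ j : ℕ, Filter.Tendsto (fun n : ℕ => (((Hofstadter.lenL k)^[j] n : ℕ) : ℝ) / (n : ℝ))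
      Filter.atTop (nhds (Hofstadter.beta k hk ^ j))) ∧
    (∀ i : ℕ, 1 ≤ i → i < k → Hofstadter.HasFreq k i (Hofstadter.alpha k hk ^ (k + i - 1))) ∧
    Hofstadter.HasFreq k k (Hofstadter.alpha k hk ^ (k - 1)) ∧
    Hofstadter.alpha k hk ^ (k - 1) = Hofstadter.beta k hk - 1 := by
  have hα := Hofstadter.alpha_pow_pred k hk
  refine ⟨fun j => ?_, fun j => ?_, Hofstadter.hasFreq_of_lt k hk, ?_, hα⟩
  · exact Hofstadter.tendsto_iterate_div (Hofstadter.alpha_spec k hk).1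
      (Hofstadter.tendsto_hofF_div k hk) j
  · exact Hofstadter.tendsto_iterate_div (Hofstadter.beta_spec k hk).1
      (Hofstadter.tendsto_lenL_div k hk) j
  · rw [hα]
    exact Hofstadter.hasFreq_self k hk
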